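/- Let $\mathbb{F}$ be any field. An algebraic branching program (ABP) is a finite directed graph without parallel edges, with a source $s$ and a sink $t$, in which every vertex carries an integer (its layer), every edge goes from some layer $i$ to layer $i+1$ (so the graph is acyclic), and every edge is labeled by a polynomial over $\mathbb{F}$. Its width is the cardinality of its largest layer, and its size is its number of vertices. It computes the sum, over all paths from $s$ to $t$, of the product of the edge labels on the path. It is a general ABP if every edge label is an affine linear form $\sum_i \alpha_i x_i+\beta$ with $\alpha_i,\beta\in\mathbb{F}$, and a weak ABP if every edge label is a simple affine linear form $\alpha x_i+\beta$ with $\alpha,\beta\in\mathbb{F}$. Let $\mathbf{VP}_2^{\mathrm{gen}}$ (respectively $\mathbf{VP}_2^{\mathrm{weak}}$) be the set of all sequences $(f_n)_{n\in\mathbb{N}}$ of polynomials over $\mathbb{F}$ in the variables $x_1,x_2,\ldots$ such that the number of variables occurring in $f_n$ is polynomially bounded in $n$ and $f_n$ is computed by a general (respectively weak) ABP of width $2$ whose size is polynomially bounded in $n$. Theorem. The polynomial $$p=(x_{11}+\cdots+x_{17})(x_{21}+\cdots+x_{27})+(x_{31}+\cdots+x_{37})(x_{41}+\cdots+x_{47})$$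 over $\mathbb{F}$ in $28$ variables $x_{ij}$ ($1\le i\le 4$, $1\le j\le 7$) is computed by a general ABP of width $2$, but by no weak ABP of width $2$. Moreover, $\mathbf{VP}_2^{\mathrm{weak}}\subsetneq\mathbf{VP}_2^{\mathrm{gen}}$. -/

import Mathlib

/-- The general affine linear forms `∑ i, α i * x i + β` (finitely many `α i` nonzero). -/
def generalForms (σ F : Type*) [Field F] : Set (MvPolynomial σ F) :=
  {l | ∃ (α : σ →₀ F) (β : F),
    l = (α.sum fun i a => MvPolynomial.C a * MvPolynomial.X i) + MvPolynomial.C β}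

/-- The simple affine linear forms `α * x i + β`. -/
def simpleForms (σ F : Type*) [Field F] : Set (MvPolynomial σ F) :=
  {l | ∃ (α β : F) (i : σ), l = MvPolynomial.C α * MvPolynomial.X i + MvPolynomial.C β}

/-- An algebraic branching program with edge labels in `L`: a finite directed graph (without
parallel edges) with a source, a sink and an integer layer for each vertex, whose edges go from
a layer to the next one (so that the graph is acyclic), and whose edges are labeled by elements
of `L`. The values of `label` on pairs of vertices that are not edges play no role. -/
structure ABP {σ F : Type*} [Field F] (L : Set (MvPolynomial σ F)) where
  /-- The number of vertices. -/
  size : ℕ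
  graph : Digraph (Fin size)
  source : Fin size
  sink : Fin size
  layer : Fin size → ℤ
  layer_succ : ∀ u v, graph.Adj u v → layer v = layer u + 1
  label : Fin size → Fin size → MvPolynomial σ F
  label_mem : ∀ u v, graph.Adj u v → label u v ∈ L

namespace ABP

variable {σ F : Type*} [Field F] {L : Set (MvPolynomial σ F)}

/-- The cardinality of the largest layer. -/
def width (Γ : ABP L) : ℕ :=
  Finset.univ.sup fun v => (Finset.univ.filter fun u => Γ.layer u = Γ.layer v).card

/-- The sequence `p 0, …, p n` of vertices is a path with `n` edges from the source to the sink. -/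
def IsPath (Γ : ABP L) {n : ℕ} (p : Fin (n + 1) → Fin Γ.size) : Prop :=
  p 0 = Γ.source ∧ p (Fin.last n) = Γ.sink ∧ ∀ i : Fin n, Γ.graph.Adj (p i.castSucc) (p i.succ)

open scoped Classical in
/-- The sum, over all paths from the source to the sink, of the products of the edge labels.
Layers increase along edges, so a path never repeats a vertex: it has fewer than `size` edges. -/
noncomputable def value (Γ : ABP L) : MvPolynomial σ F :=
  ∑ n ∈ Finset.range Γ.size, ∑ p : Fin (n + 1) → Fin Γ.size with Γ.IsPath p,
    ∏ i : Fin n, Γ.label (p i.castSucc) (p i.succ)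

end ABP

/-- The polynomially bounded functions `ℕ → ℕ`. -/
def PolyBounded (t : ℕ → ℕ) : Prop :=
  ∃ q : Polynomial ℕ, ∀ n, t n ≤ q.eval n

/-- The families of polynomials (in the variables `x 0, x 1, …`) that involve polynomially many
variables and are computed by width-`k` ABPs of polynomially bounded size with edge labels
in `L`. -/
def VP {F : Type*} [Field F] (k : ℕ) (L : Set (MvPolynomial ℕ F)) :
    Set (ℕ → MvPolynomial ℕ F) :=
  {f | PolyBounded (fun n => (f n).vars.card) ∧
    ∃ t : ℕ → ℕ, PolyBounded t ∧
      ∀ n, ∃ Γ : ABP L, Γ.width = k ∧ Γ.size ≤ t n ∧ Γ.value = f n}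

/-- The class `VP_k` for general affine linear edge labels. -/
abbrev VPgen (F : Type*) [Field F] (k : ℕ) : Set (ℕ → MvPolynomial ℕ F) :=
  VP k (generalForms ℕ F)

/-- The class `VP_k` for simple affine linear edge labels. -/
abbrev VPweak (F : Type*) [Field F] (k : ℕ) : Set (ℕ → MvPolynomial ℕ F) :=
  VP k (simpleForms ℕ F)

/-- The polynomial `(∑ⱼ x₁ⱼ) (∑ⱼ x₂ⱼ) + (∑ⱼ x₃ⱼ) (∑ⱼ x₄ⱼ)` in `28` variables, with `xᵢⱼ` written
as `X (i - 1, j - 1)`. -/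
noncomputable def sepPoly (F : Type*) [Field F] : MvPolynomial (Fin 4 × Fin 7) F :=
  (∑ j, MvPolynomial.X (0, j)) * (∑ j, MvPolynomial.X (1, j)) +
    (∑ j, MvPolynomial.X (2, j)) * (∑ j, MvPolynomial.X (3, j))

/-! The edges between two consecutive layers of a width-two program form a 2 × 2 matrix, so its
value is a matrix product between constant vectors (`exists_value_eq_bilin`). After extending
scalars, the field may be taken algebraically closed.

If all determinants are nonzero constants, each factor is a constant matrix times a transvection `1
+ l • u (perp u)ᵀ` (`exists_vecMul_eq_shear`). Constant matrices are absorbed by changing the axes,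
and neighbouring transvections with the same axis merge. What remains has a product of linear forms
as its top-degree part, so it computes no irreducible quadratic form
(`Reduced.not_irreducible_pair`).

For simple labels the general case reduces to this one. With constants substituted for at most six
variables, each of the four sums in `sepPoly` keeps a variable, so the result is `xy + zw` up to an
affine change of variables, hence irreducible. A matrix involving four variables could be
annihilated by fixing them, so each matrix involves at most three. A matrix whose determinant is not
a nonzero constant becomes singular at some point; fixing its variables there splits the product
into two factors, one of which must be constant. Choosing a shortest suffix that computes a
restriction of `sepPoly` excludes one case; the other leads back to constant determinants with at
most 3 + 3 variables fixed (`bilin_prod_ne_sepPoly`). -/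

namespace WidthTwo

open MvPolynomial

/-! ### Reduced products of transvections -/

section Shear

variable {σ K : Type*} [Field K]

/-- Multiplication by a linear form shifts the homogeneous components by one. -/
theorem homogeneousComponent_succ_mul {l : MvPolynomial σ K} (hl : l.IsHomogeneous 1)
    (f : MvPolynomial σ K) (n : ℕ) :
    homogeneousComponent (n + 1) (f * l) = homogeneousComponent n f * l := by
  let _ : GradedAlgebra (homogeneousSubmodule σ K) := gradedAlgebra
  have := DirectSum.coe_decompose_mul_add_of_right_mem (homogeneousSubmodule σ K) (i := n) (j := 1)
    (a := f) (b := l) hl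
  rw [← decomposition.decompose'_apply, ← decomposition.decompose'_apply]
  exact this

/-- The product of a polynomial row vector and a constant column vector. -/
noncomputable def pair (w : Fin 2 → MvPolynomial σ K) (u : Fin 2 → K) : MvPolynomial σ K :=
  w 0 * C (u 0) + w 1 * C (u 1)

/-- The vector obtained by a quarter turn. -/
def perp (u : Fin 2 → K) : Fin 2 → K := ![-u 1, u 0]

/-- The product of the row vector `w` and the transvection `1 + l • u (perp u)ᵀ`. -/
noncomputable def shear (w : Fin 2 → MvPolynomial σ K) (l : MvPolynomial σ K) (u : Fin 2 → K) :
    Fin 2 → MvPolynomial σ K :=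
  fun j => w j + pair w u * l * C (perp u j)

/-- The product of a row vector and a constant matrix. -/
noncomputable def constMul (w : Fin 2 → MvPolynomial σ K) (A : Matrix (Fin 2) (Fin 2) K) :
    Fin 2 → MvPolynomial σ K :=
  fun j => w 0 * C (A 0 j) + w 1 * C (A 1 j)

/-- Row vectors obtained from a nonzero constant vector by multiplication with transvections, no
two consecutive ones having the same axis. `Reduced w c h d` records that the part of degree `d`
of `w` is `h • c` and that all other parts have smaller degree. -/
inductive Reduced : (Fin 2 → MvPolynomial σ K) → (Fin 2 → K) → MvPolynomial σ K → ℕ → Prop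
  | const (c : Fin 2 → K) (hc : c ≠ 0) : Reduced (fun j => C (c j)) c 1 0
  | step {w c h d} (hw : Reduced w c h d) (l : MvPolynomial σ K) (u : Fin 2 → K)
      (hl : l.IsHomogeneous 1) (hl0 : l ≠ 0) (hu : c 0 * u 0 + c 1 * u 1 ≠ 0) :
      Reduced (shear w l u) (perp u) (h * l * C (c 0 * u 0 + c 1 * u 1)) (d + 1)

theorem Reduced.ne_zero {w : Fin 2 → MvPolynomial σ K} {c h d} (hw : Reduced w c h d) : c ≠ 0 := by
  cases hw with
  | const c hc => exact hc
  | @step w c h d hw l u hl hl0 hu =>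
    intro h0
    have h1 := congrFun h0 0
    have h2 := congrFun h0 1
    simp [perp] at h1 h2
    simp [h1, h2] at hu

theorem Reduced.isHomogeneous {w : Fin 2 → MvPolynomial σ K} {c h d} (hw : Reduced w c h d) :
    h.IsHomogeneous d := by
  induction hw with
  | const c hc => exact isHomogeneous_one σ K
  | step hw l u hl hl0 hu ih => exact (ih.mul hl).mul (isHomogeneous_C σ _)

/-- As `c` is not orthogonal to `u`, the top part of `pair w u` survives in degree `d`; multiplied
by `l` it becomes the only contribution in degree `d + 1`. -/
theorem Reduced.leading {w : Fin 2 → MvPolynomial σ K} {c h d} (hw : Reduced w c h d) (j : Fin 2) :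
    homogeneousComponent d (w j) = h * C (c j) ∧
      ∀ n, d < n → homogeneousComponent n (w j) = 0 := by
  induction hw generalizing j with
  | const c hc =>
    refine ⟨by simp [homogeneousComponent_zero], fun n hn => ?_⟩
    exact homogeneousComponent_eq_zero _ _ (by simpa using hn)
  | @step w c h d hw l u hl hl0 hu ih =>
    have key : ∀ n, homogeneousComponent (n + 1) (shear w l u j) =
        homogeneousComponent (n + 1) (w j) + (homogeneousComponent n (w 0) * C (u 0) +
          homogeneousComponent n (w 1) * C (u 1)) * l * C (perp u j) := by
      intro n
      simp only [shear, pair, map_add, mul_comm _ (C _), homogeneousComponent_C_mul]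
      rw [homogeneousComponent_succ_mul hl]
      simp only [map_add, homogeneousComponent_C_mul]
    constructor
    · rw [key, (ih j).2 _ (Nat.lt_succ_self d), (ih 0).1, (ih 1).1]
      simp only [map_add, map_mul]
      ring
    · intro n hn
      obtain ⟨m, rfl⟩ : ∃ m, n = m + 1 := ⟨n - 1, by omega⟩
      rw [key, (ih j).2 _ (by omega), (ih 0).2 _ (by omega), (ih 1).2 _ (by omega)]
      simp

/-- Conjugating a transvection by `A` gives another one: with `v = adj(A) u` one has `(perp u)ᵀ A =
(perp v)ᵀ` and `A v = det(A) u`, so `A` moves to the left past it at the cost of replacing `l` by `l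
/ det A`. -/
theorem Reduced.constMul {w : Fin 2 → MvPolynomial σ K} {c h d} (hw : Reduced w c h d)
    (A : Matrix (Fin 2) (Fin 2) K) (hA : A.det ≠ 0) :
    ∃ h', Reduced (constMul w A) (fun j => c 0 * A 0 j + c 1 * A 1 j) h' d := by
  rw [Matrix.det_fin_two] at hA
  induction hw with
  | const c hc =>
    refine ⟨1, ?_⟩
    have : WidthTwo.constMul (fun j => (C (c j) : MvPolynomial σ K)) A =
        fun j => C (c 0 * A 0 j + c 1 * A 1 j) := by
      funext j; simp [WidthTwo.constMul]
    rw [this]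
    refine .const _ fun h0 => hc ?_
    have h1 := congrFun h0 0
    have h2 := congrFun h0 1
    simp only [Pi.zero_apply] at h1 h2
    have e0 : c 0 * (A 0 0 * A 1 1 - A 0 1 * A 1 0) = 0 := by
      linear_combination A 1 1 * h1 - A 1 0 * h2
    have e1 : c 1 * (A 0 0 * A 1 1 - A 0 1 * A 1 0) = 0 := by
      linear_combination A 0 0 * h2 - A 0 1 * h1
    funext j
    fin_cases j
    · simpa [hA] using e0
    · simpa [hA] using e1
  | @step w c h d hw l u hl hl0 hu ih =>
    obtain ⟨h', ih⟩ := ih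
    set D := A 0 0 * A 1 1 - A 0 1 * A 1 0 with hD
    let v : Fin 2 → K := ![A 1 1 * u 0 - A 0 1 * u 1, A 0 0 * u 1 - A 1 0 * u 0]
    have hv : (c 0 * A 0 0 + c 1 * A 1 0) * v 0 + (c 0 * A 0 1 + c 1 * A 1 1) * v 1 =
        D * (c 0 * u 0 + c 1 * u 1) := by
      simp [v, hD]; ring
    have hDC : (C D⁻¹ : MvPolynomial σ K) * C D = 1 := by
      rw [← C_mul, inv_mul_cancel₀ hA, C_1]
    have := ih.step (C D⁻¹ * l) v (by simpa using (isHomogeneous_C σ D⁻¹).mul hl)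
      (mul_ne_zero (by simpa using hA) hl0) (by rw [hv]; exact mul_ne_zero hA hu)
    refine ⟨h' * (C D⁻¹ * l) * C ((c 0 * A 0 0 + c 1 * A 1 0) * v 0 +
      (c 0 * A 0 1 + c 1 * A 1 1) * v 1), ?_⟩
    convert this using 1
    · funext j
      have hp : pair (WidthTwo.constMul w A) v = C D * pair w u := by
        simp only [pair, WidthTwo.constMul, v, hD, map_sub, map_mul, Matrix.cons_val_zero,
          Matrix.cons_val_one]
        ring
      simp only [shear, hp]
      have : C D * pair w u * (C D⁻¹ * l) = pair w u * l := by
        linear_combination pair w u * l * hDC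
      rw [this]
      simp only [WidthTwo.constMul, shear]
      fin_cases j <;> simp [perp, v] <;> ring
    · funext j
      fin_cases j <;> simp [perp, v] <;> ring

/-- Reduced vectors are stable under all transvections by linear forms. -/
theorem Reduced.shear {w : Fin 2 → MvPolynomial σ K} {c h d} (hw : Reduced w c h d)
    (l : MvPolynomial σ K) (u : Fin 2 → K) (hl : l.IsHomogeneous 1) :
    ∃ c' h' d', Reduced (shear w l u) c' h' d' := by
  by_cases hl0 : l = 0
  · refine ⟨c, h, d, ?_⟩
    have : WidthTwo.shear w l u = w := by funext j; simp [WidthTwo.shear, hl0]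
    rwa [this]
  by_cases hu : c 0 * u 0 + c 1 * u 1 = 0
  swap
  · exact ⟨_, _, _, hw.step l u hl hl0 hu⟩
  cases hw with
  | const c hc =>
    refine ⟨c, 1, 0, ?_⟩
    have : WidthTwo.shear (fun j => (C (c j) : MvPolynomial σ K)) l u = fun j => C (c j) := by
      have : pair (fun j => (C (c j) : MvPolynomial σ K)) u = 0 := by
        rw [pair, ← C_mul, ← C_mul, ← C_add, hu, C_0]
      funext j; simp [WidthTwo.shear, this]
    rw [this]
    exact .const c hc
  | @step w c h d hw l₀ u₀ hl₀ hl₀0 hu₀ =>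
    -- Here `hu` says that `u` is orthogonal to `perp u₀`, so both transvections have the same axis
    -- and merge into one with form `l₀ + r² l`.
    obtain ⟨r, hr⟩ : ∃ r : K, ∀ j, u j = r * u₀ j := by
      simp only [perp, Matrix.cons_val_zero, Matrix.cons_val_one] at hu
      by_cases h0 : u₀ 0 = 0
      · have h1 : u₀ 1 ≠ 0 := by
          intro h1; simp [h0, h1] at hu₀
        refine ⟨u 1 / u₀ 1, fun j => ?_⟩
        have : u 0 = 0 := by simpa [h0, h1] using hu
        fin_cases j
        · simp [h0, this]
        · simp [h1]
      · refine ⟨u 0 / u₀ 0, fun j => ?_⟩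
        fin_cases j
        · simp [h0]
        · simp only [Fin.mk_one]; field_simp; linear_combination hu
    have hs : WidthTwo.shear (WidthTwo.shear w l₀ u₀) l u =
        WidthTwo.shear w (l₀ + C (r * r) * l) u₀ := by
      funext j
      have hp : pair (WidthTwo.shear w l₀ u₀) u = C r * pair w u₀ := by
        simp only [pair, WidthTwo.shear, hr, perp, map_mul, map_neg, Matrix.cons_val_zero,
          Matrix.cons_val_one]
        ring
      have hq : perp u j = r * perp u₀ j := by
        fin_cases j <;> simp [perp, hr]
      rw [WidthTwo.shear, hp, hq]
      simp only [WidthTwo.shear, map_mul]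
      ring
    rw [hs]
    -- The merged transvection may be trivial; then the word shrinks to `w`.
    by_cases h0 : l₀ + C (r * r) * l = 0
    · refine ⟨c, h, d, ?_⟩
      have : WidthTwo.shear w (l₀ + C (r * r) * l) u₀ = w := by
        funext j; simp only [WidthTwo.shear, h0, mul_zero, zero_mul, add_zero]
      rwa [this]
    · exact ⟨_, _, _, hw.step _ u₀
        (hl₀.add (by simpa using (isHomogeneous_C σ (r * r)).mul hl)) h0 hu₀⟩

theorem not_isUnit_of_isHomogeneous_succ {f : MvPolynomial σ K} {n : ℕ}
    (hf : f.IsHomogeneous (n + 1)) : ¬ IsUnit f := by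
  intro hu
  have := hu.map (constantCoeff (σ := σ) (R := K))
  rw [constantCoeff_eq, hf.coeff_eq_zero (by simp)] at this
  exact not_isUnit_zero this

/-- A quadratic form that is a linear combination of the entries of a reduced vector is
reducible: it is a constant multiple of a product of linear forms. -/
theorem Reduced.not_irreducible_pair {w : Fin 2 → MvPolynomial σ K} {c h d}
    (hw : Reduced w c h d) (b : Fin 2 → K) (hf : (pair w b).IsHomogeneous 2) :
    ¬ Irreducible (pair w b) := by
  -- If `b` is not orthogonal to `c`, the degree-`d` part of `pair w b` is a nonzero multiple of
  -- `h`. Homogeneity then forces `d = 2`, where `h` is a product of two linear forms up to a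
  -- constant.
  have main : ∀ {w : Fin 2 → MvPolynomial σ K} {c h d}, Reduced w c h d →
      c 0 * b 0 + c 1 * b 1 ≠ 0 → (pair w b).IsHomogeneous 2 → ¬ Irreducible (pair w b) := by
    intro w c h d hw hb hf hirr
    have hcomp : ∀ n, homogeneousComponent n (pair w b) =
        homogeneousComponent n (w 0) * C (b 0) + homogeneousComponent n (w 1) * C (b 1) := by
      intro n
      simp only [pair, mul_comm _ (C _), map_add, homogeneousComponent_C_mul]
    have hself : homogeneousComponent 2 (pair w b) = pair w b := homogeneousComponent_eq_self hf
    have hd2 : 2 ≤ d := by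
      by_contra hlt
      apply hirr.ne_zero
      rw [← hself, hcomp, (hw.leading 0).2 _ (by omega), (hw.leading 1).2 _ (by omega)]
      simp
    have hd : homogeneousComponent d (pair w b) = h * C (c 0 * b 0 + c 1 * b 1) := by
      rw [hcomp, (hw.leading 0).1, (hw.leading 1).1]
      simp only [map_add, map_mul]; ring
    cases hw with
    | const => omega
    | @step w c h d hw l u hl hl0 hu =>
      obtain ⟨m, rfl⟩ : ∃ m, d = m + 1 := ⟨d - 1, by omega⟩
      have hh := hw.isHomogeneous
      by_cases hm : m = 0
      · subst hm
        rw [hself] at hd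
        rw [hd, mul_assoc, mul_assoc] at hirr
        rcases hirr.isUnit_or_isUnit rfl with h1 | h1
        · exact not_isUnit_of_isHomogeneous_succ hh h1
        · exact not_isUnit_of_isHomogeneous_succ hl (isUnit_of_mul_isUnit_left h1)
      · rw [homogeneousComponent_of_mem hf, if_neg (by omega)] at hd
        have h0 : ∀ {w : Fin 2 → MvPolynomial σ K} {c h d}, Reduced w c h d → h ≠ 0 := by
          intro w c h d hw
          induction hw with
          | const => exact one_ne_zero
          | step hw l u hl hl0 hu ih => exact mul_ne_zero (mul_ne_zero ih hl0) (C_ne_zero.mpr hu)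
        exact mul_ne_zero (h0 (hw.step l u hl hl0 hu)) (C_ne_zero.mpr hb) hd.symm
  by_cases hb : c 0 * b 0 + c 1 * b 1 = 0
  swap
  · exact main hw hb hf
  cases hw with
  | const c hc =>
    have : pair (fun j => (C (c j) : MvPolynomial σ K)) b = 0 := by
      rw [pair, ← C_mul, ← C_mul, ← C_add, hb, C_0]
    rw [this]
    exact not_irreducible_zero
  | @step w c h d hw l u hl hl0 hu =>
    -- Now `b` is orthogonal to `perp u`, so the last transvection fixes `b` and can be dropped. If
    -- `b` is also orthogonal to the previous `c`, then `b = 0`, since `c` and `perp u` are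
    -- independent.
    have hp : pair (WidthTwo.shear w l u) b = pair w b := by
      have : (C (perp u 0) : MvPolynomial σ K) * C (b 0) + C (perp u 1) * C (b 1) = 0 := by
        rw [← C_mul, ← C_mul, ← C_add, hb, C_0]
      simp only [pair, WidthTwo.shear] at this ⊢
      linear_combination (w 0 * C (u 0) + w 1 * C (u 1)) * l * this
    rw [hp] at hf ⊢
    by_cases hcb : c 0 * b 0 + c 1 * b 1 = 0
    · have hb0 : pair w b = 0 := by
        simp only [perp, Matrix.cons_val_zero, Matrix.cons_val_one] at hb
        have e0 : b 0 * (c 0 * u 0 + c 1 * u 1) = 0 := by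
          linear_combination u 0 * hcb - c 1 * hb
        have e1 : b 1 * (c 0 * u 0 + c 1 * u 1) = 0 := by
          linear_combination u 1 * hcb + c 0 * hb
        have e0' : b 0 = 0 := by simpa [hu] using e0
        have e1' : b 1 = 0 := by simpa [hu] using e1
        simp [pair, e0', e1']
      rw [hb0]
      exact not_irreducible_zero
    · exact main hw hcb hf

end Shear

end WidthTwo

namespace WidthTwo

open MvPolynomial Matrix

/-! ### Matrices of affine forms with constant determinant -/

section UnitDet

variable {σ K : Type*} [Field K]

theorem eq_C_of_isUnit {f : MvPolynomial σ K} (hf : IsUnit f) : ∃ c : K, c ≠ 0 ∧ f = C c := by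
  obtain ⟨c, hc, h⟩ := isUnit_iff_eq_C_of_isReduced.mp hf
  exact ⟨c, hc.ne_zero, h⟩

theorem eq_C_add_of_totalDegree_le_one {f : MvPolynomial σ K} (hf : f.totalDegree ≤ 1) :
    ∃ (a : K) (l : MvPolynomial σ K), l.IsHomogeneous 1 ∧ f = C a + l := by
  refine ⟨coeff 0 f, homogeneousComponent 1 f, homogeneousComponent_isHomogeneous 1 f, ?_⟩
  rw [← homogeneousComponent_zero]
  conv_lhs => rw [← sum_homogeneousComponent f]
  rcases Nat.le_one_iff_eq_zero_or_eq_one.mp hf with h | h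
  · rw [h, homogeneousComponent_eq_zero 1 f (by omega)]
    simp
  · rw [h]
    simp [Finset.sum_range_succ]

theorem irreducible_of_isHomogeneous_one {f : MvPolynomial σ K} (hf : f.IsHomogeneous 1)
    (h0 : f ≠ 0) : Irreducible f := by
  refine irreducible_of_totalDegree_eq_one (hf.totalDegree h0) fun x hx => ?_
  by_contra hu
  have hx0 : x = 0 := by simpa using hu
  apply h0
  ext m
  simpa [hx0] using hx m

/-- A nilpotent matrix of linear forms is a linear form times a constant nilpotent matrix. -/
theorem exists_eq_of_sq_add_mul_eq_zero {f g h : MvPolynomial σ K} (hf : f.IsHomogeneous 1)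
    (hg : g.IsHomogeneous 1) (hh : h.IsHomogeneous 1) (H : f * f + g * h = 0) :
    ∃ (l : MvPolynomial σ K) (u : Fin 2 → K), l.IsHomogeneous 1 ∧
      f = l * C (-(u 0 * u 1)) ∧ g = l * C (u 0 * u 0) ∧ h = l * C (-(u 1 * u 1)) := by
  by_cases h0 : f = 0
  · have : g = 0 ∨ h = 0 := by simpa [h0] using H
    rcases this with hg0 | hh0
    · refine ⟨-h, ![0, 1], hh.neg, by simp [h0], by simp [hg0], by simp⟩
    · refine ⟨g, ![1, 0], hg, by simp [h0], by simp, by simp [hh0]⟩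
  have hirr := irreducible_of_isHomogeneous_one hf h0
  have key : ∀ {g : MvPolynomial σ K}, g.IsHomogeneous 1 → g ≠ 0 → f ∣ g →
      ∃ r : K, r ≠ 0 ∧ g = f * C r := by
    rintro g hg hg0 ⟨k, rfl⟩
    have hk : k ≠ 0 := right_ne_zero_of_mul hg0
    have hd := hg.totalDegree hg0
    rw [totalDegree_mul_of_isDomain h0 hk, hf.totalDegree h0] at hd
    have hkC := totalDegree_eq_zero_iff_eq_C.mp (show k.totalDegree = 0 by omega)
    refine ⟨coeff 0 k, fun hc => hk ?_, by rw [← hkC]⟩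
    rw [hkC, hc, C_0]
  have hgh : g * h ≠ 0 := by
    intro h1
    rw [h1, add_zero] at H
    exact h0 (mul_self_eq_zero.mp H)
  have hg0 := left_ne_zero_of_mul hgh
  have hh0 := right_ne_zero_of_mul hgh
  have hdvd : f ∣ g * h := ⟨-f, by linear_combination H⟩
  -- Normalizing `u 0 = 1` lets `l = g` absorb the scalar, so no square root is needed.
  have fin : ∀ r : K, r ≠ 0 → g = f * C r → h = f * C (-r⁻¹) → _ := fun r hr h1 h2 =>
    (⟨f * C r, ![1, -r⁻¹], by simpa using hf.mul (isHomogeneous_C σ r), by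
      have : (C r : MvPolynomial σ K) * C (r⁻¹) = 1 := by rw [← C_mul, mul_inv_cancel₀ hr, C_1]
      simp [mul_assoc, this], by simpa using h1, by
      have : (C r : MvPolynomial σ K) * C (r⁻¹) = 1 := by rw [← C_mul, mul_inv_cancel₀ hr, C_1]
      rw [h2]
      simp only [cons_val_one, map_neg, map_mul, cons_val_fin_one]
      linear_combination f * C r⁻¹ * this⟩ :
    ∃ (l : MvPolynomial σ K) (u : Fin 2 → K), l.IsHomogeneous 1 ∧
      f = l * C (-(u 0 * u 1)) ∧ g = l * C (u 0 * u 0) ∧ h = l * C (-(u 1 * u 1)))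
  rcases hirr.prime.dvd_or_dvd hdvd with hd | hd
  · obtain ⟨r, hr, hgr⟩ := key hg hg0 hd
    refine fin r hr hgr ?_
    have hC : (C r : MvPolynomial σ K) * C (r⁻¹) = 1 := by rw [← C_mul, mul_inv_cancel₀ hr, C_1]
    rw [hgr] at H
    apply mul_left_cancel₀ h0
    rw [map_neg]
    linear_combination C r⁻¹ * H - f * h * hC
  · obtain ⟨r, hr, hhr⟩ := key hh hh0 hd
    have hC : (C r : MvPolynomial σ K) * C (r⁻¹) = 1 := by rw [← C_mul, mul_inv_cancel₀ hr, C_1]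
    refine fin (-r⁻¹) (by simpa using hr) ?_ (by simpa using hhr)
    rw [hhr] at H
    apply mul_left_cancel₀ h0
    rw [map_neg]
    linear_combination C r⁻¹ * H - f * g * hC

/-- A matrix of affine forms whose determinant is a nonzero constant is the product of a constant
matrix and a transvection. -/
theorem exists_vecMul_eq_shear {N : Matrix (Fin 2) (Fin 2) (MvPolynomial σ K)}
    (hN : ∀ i j, (N i j).totalDegree ≤ 1) (hdet : IsUnit N.det) :
    ∃ (A : Matrix (Fin 2) (Fin 2) K) (l : MvPolynomial σ K) (u : Fin 2 → K), A.det ≠ 0 ∧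
      l.IsHomogeneous 1 ∧ ∀ w, w ᵥ* N = shear (constMul w A) l u := by
  choose a L hL hNL using fun i j => eq_C_add_of_totalDegree_le_one (hN i j)
  obtain ⟨c, hc, hdc⟩ := eq_C_of_isUnit hdet
  -- `D`, `T` and `Q` are the parts of degree 0, 1 and 2 of the determinant of `a + L`.
  set D := a 0 0 * a 1 1 - a 0 1 * a 1 0 with hD
  set T := C (a 1 1) * L 0 0 - C (a 0 1) * L 1 0 + (C (a 0 0) * L 1 1 - C (a 1 0) * L 0 1) with hT
  set Q := L 0 0 * L 1 1 - L 0 1 * L 1 0 with hQ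
  have hCL : ∀ r i j, (C r * L i j).IsHomogeneous 1 := fun r i j => by
    simpa using (isHomogeneous_C σ r).mul (hL i j)
  have hT1 : T.IsHomogeneous 1 :=
    ((hCL _ _ _).sub (hCL _ _ _)).add ((hCL _ _ _).sub (hCL _ _ _))
  have hQ2 : Q.IsHomogeneous 2 := ((hL _ _).mul (hL _ _)).sub ((hL _ _).mul (hL _ _))
  have hexp : C c = C D + T + Q := by
    rw [← hdc, det_fin_two]
    simp only [hNL, hD, hT, hQ, map_sub, map_mul]
    ring
  have hcomp : ∀ n, homogeneousComponent n (C c : MvPolynomial σ K) =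
      homogeneousComponent n (C D) + homogeneousComponent n T + homogeneousComponent n Q := by
    intro n; rw [hexp, map_add, map_add]
  have hT0 : T = 0 := by
    have := hcomp 1
    rw [homogeneousComponent_of_mem (isHomogeneous_C σ c),
      homogeneousComponent_of_mem (isHomogeneous_C σ D), homogeneousComponent_of_mem hT1,
      homogeneousComponent_of_mem hQ2] at this
    simpa using this.symm
  have hQ0 : Q = 0 := by
    have := hcomp 2
    rw [homogeneousComponent_of_mem (isHomogeneous_C σ c),
      homogeneousComponent_of_mem (isHomogeneous_C σ D), homogeneousComponent_of_mem hT1,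
      homogeneousComponent_of_mem hQ2] at this
    simpa using this.symm
  have hD0 : D ≠ 0 := by
    rw [hT0, hQ0, add_zero, add_zero] at hexp
    rw [← C_injective σ K hexp]
    exact hc
  have hCD : (C D : MvPolynomial σ K) = C (a 0 0) * C (a 1 1) - C (a 0 1) * C (a 1 0) := by
    simp [hD]
  have hDC : (C D⁻¹ : MvPolynomial σ K) * C D = 1 := by
    rw [← C_mul, inv_mul_cancel₀ hD0, C_1]
  -- The matrix `adj(a) L` has trace `T = 0` and determinant `D Q = 0`, so it is nilpotent and
  -- equals `l • u (perp u)ᵀ`. Multiplying by `D⁻¹ a` recovers `L`.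
  obtain ⟨l, u, hl, h00, h01, h10⟩ := exists_eq_of_sq_add_mul_eq_zero
    (f := C (a 1 1) * L 0 0 - C (a 0 1) * L 1 0) (g := C (a 1 1) * L 0 1 - C (a 0 1) * L 1 1)
    (h := C (a 0 0) * L 1 0 - C (a 1 0) * L 0 0)
    ((hCL _ _ _).sub (hCL _ _ _)) ((hCL _ _ _).sub (hCL _ _ _)) ((hCL _ _ _).sub (hCL _ _ _)) (by
      linear_combination (C (a 1 1) * L 0 0 - C (a 0 1) * L 1 0) * hT0 -
        (C (a 0 0) * C (a 1 1) - C (a 0 1) * C (a 1 0)) * hQ0)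
  have h11 : C (a 0 0) * L 1 1 - C (a 1 0) * L 0 1 = l * C (u 0 * u 1) := by
    rw [map_neg] at h00
    linear_combination hT0 - h00
  refine ⟨Matrix.of a, C D⁻¹ * l, u, ?_, by simpa using (isHomogeneous_C σ D⁻¹).mul hl, ?_⟩
  · rw [det_fin_two]
    exact hD0
  intro w
  have hLij : ∀ i j, L i j = (C (a i 0) * C (u 0) + C (a i 1) * C (u 1)) * (C D⁻¹ * l) *
      C (perp u j) := by
    intro i j
    have : C D * L i j = (C (a i 0) * C (u 0) + C (a i 1) * C (u 1)) * l * C (perp u j) := by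
      rw [hCD]
      simp only [map_neg, map_mul] at h00 h01 h10 h11
      fin_cases i <;> fin_cases j <;>
        simp only [Fin.zero_eta, Fin.mk_one, perp, cons_val_zero, cons_val_one, map_neg]
      · linear_combination C (a 0 0) * h00 + C (a 0 1) * h10
      · linear_combination C (a 0 0) * h01 + C (a 0 1) * h11
      · linear_combination C (a 1 0) * h00 + C (a 1 1) * h10
      · linear_combination C (a 1 0) * h01 + C (a 1 1) * h11
    linear_combination C D⁻¹ * this - L i j * hDC
  funext j
  simp only [vecMul, dotProduct, Fin.sum_univ_two, shear, constMul, pair, hNL, of_apply]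
  rw [hLij 0 j, hLij 1 j]
  ring

/-- Products of matrices of affine forms with nonzero constant determinants keep a vector
reduced. -/
theorem Reduced.vecMul_prod (Ns : List (Matrix (Fin 2) (Fin 2) (MvPolynomial σ K)))
    (hN : ∀ N ∈ Ns, (∀ i j, (N i j).totalDegree ≤ 1) ∧ IsUnit N.det) :
    ∀ {w : Fin 2 → MvPolynomial σ K} {c h d}, Reduced w c h d →
      ∃ c' h' d', Reduced (w ᵥ* Ns.prod) c' h' d' := by
  induction Ns with
  | nil => intro w c h d hw; exact ⟨c, h, d, by simpa using hw⟩
  | cons N Ns ih =>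
    intro w c h d hw
    obtain ⟨A, l, u, hA, hl, hsh⟩ := exists_vecMul_eq_shear (hN N (by simp)).1 (hN N (by simp)).2
    obtain ⟨h₁, hw₁⟩ := hw.constMul A hA
    obtain ⟨c₂, h₂, d₂, hw₂⟩ := hw₁.shear l u hl
    rw [List.prod_cons, ← vecMul_vecMul, hsh]
    exact ih (fun M hM => hN M (by simp [hM])) hw₂

/-- A product of matrices of affine forms with nonzero constant determinants does not compute an
irreducible quadratic form. -/
theorem not_irreducible_of_isUnit_det (Ns : List (Matrix (Fin 2) (Fin 2) (MvPolynomial σ K)))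
    (hN : ∀ N ∈ Ns, (∀ i j, (N i j).totalDegree ≤ 1) ∧ IsUnit N.det) (a b : Fin 2 → K)
    (hf : (((fun i => C (a i)) ᵥ* Ns.prod) ⬝ᵥ fun i => C (b i)).IsHomogeneous 2) :
    ¬ Irreducible (((fun i => C (a i)) ᵥ* Ns.prod) ⬝ᵥ fun i => (C (b i) : MvPolynomial σ K)) := by
  by_cases ha : a = 0
  · have : (fun i => (C (a i) : MvPolynomial σ K)) = 0 := by funext i; simp [ha]
    rw [this, zero_vecMul, zero_dotProduct]
    exact not_irreducible_zero
  obtain ⟨c, h, d, hw⟩ := Reduced.vecMul_prod Ns hN (.const a ha)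
  have hp : ∀ w : Fin 2 → MvPolynomial σ K, w ⬝ᵥ (fun i => C (b i)) = pair w b := by
    intro w; simp [dotProduct, pair, Fin.sum_univ_two]
  rw [hp] at hf ⊢
  exact hw.not_irreducible_pair b hf

end UnitDet

end WidthTwo

/-! ### Zeros of polynomials and substitution of constants -/

namespace WidthTwo

open MvPolynomial Matrix

/-- Over an algebraically closed field, every polynomial that is not a unit has a zero. -/
theorem exists_eval_eq_zero {σ K : Type*} [Field K] [Finite σ] [IsAlgClosed K] {f : MvPolynomial σ K} (hf : ¬ IsUnit f) :
    ∃ x : σ → K, eval x f = 0 := by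
  obtain ⟨I, hI, hfI⟩ := exists_max_ideal_of_mem_nonunits hf
  obtain ⟨x, hx⟩ := (isMaximal_iff_eq_vanishingIdeal_singleton (K := K)).mp hI
  refine ⟨x, ?_⟩
  rw [hx, mem_vanishingIdeal_singleton_iff] at hfI
  simpa [aeval_eq_eval] using hfI

section Subst

variable {σ K : Type*} [Field K] [DecidableEq σ]

/-- The substitution of constants for the variables in `S`. -/
noncomputable def subst (S : Finset σ) (g : σ → K) : MvPolynomial σ K →ₐ[K] MvPolynomial σ K :=
  aeval fun i => if i ∈ S then C (g i) else X i

theorem subst_X (S : Finset σ) (g : σ → K) (i : σ) :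
    subst S g (X i) = if i ∈ S then C (g i) else X i :=
  aeval_X _ i

theorem subst_C (S : Finset σ) (g : σ → K) (a : K) : subst S g (C a) = C a :=
  aeval_C _ a

theorem subst_congr {S : Finset σ} {g g' : σ → K} (h : ∀ i ∈ S, g i = g' i) :
    subst S g = subst S g' := by
  refine algHom_ext fun i => ?_
  rw [subst_X, subst_X]
  split_ifs with hi
  · rw [h i hi]
  · rfl

theorem subst_subst (S T : Finset σ) (g : σ → K) (f : MvPolynomial σ K) :
    subst T g (subst S g f) = subst (S ∪ T) g f := by
  have : (subst T g).comp (subst S g) = subst (S ∪ T) g := by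
    refine algHom_ext fun i => ?_
    rw [AlgHom.comp_apply, subst_X, subst_X]
    by_cases hi : i ∈ S
    · simp [hi]
    · simp [hi, subst_X]
  exact DFunLike.congr_fun this f

theorem eval_subst (S : Finset σ) (g h : σ → K) (f : MvPolynomial σ K) :
    eval h (subst S g f) = eval (fun i => if i ∈ S then g i else h i) f := by
  have : (aeval h).comp (subst S g) = aeval fun i => if i ∈ S then g i else h i := by
    refine algHom_ext fun i => ?_
    rw [AlgHom.comp_apply, subst_X, aeval_X]
    split_ifs <;> simp
  simpa [aeval_eq_eval] using DFunLike.congr_fun this f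

end Subst

/-! ### Irreducibility of the restrictions of `sepPoly` -/

section SepPoly

variable {K : Type*} [Field K]

/-- The polynomial has degree one in `X a`, and its coefficients `X b` and `X c * X d` are coprime.
-/
theorem irreducible_X_mul_X_add_X_mul_X {σ : Type*} {a b c d : σ} (hab : a ≠ b) (hac : a ≠ c)
    (had : a ≠ d) (hbc : b ≠ c) (hbd : b ≠ d) :
    Irreducible (X a * X b + X c * X d : MvPolynomial σ K) := by
  classical
  rw [mul_comm (X a)]
  refine irreducible_mul_X_add _ _ a (X_ne_zero b) ?_ ?_ ?_
  · simpa [vars_X] using hab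
  · intro h
    have := vars_mul _ _ h
    simp [vars_X, hac, had] at this
  · have hp : Prime (X b : MvPolynomial σ K) := X_prime
    rw [hp.irreducible.isRelPrime_iff_not_dvd]
    intro h
    rcases hp.dvd_or_dvd h with h | h
    · exact hbc (X_dvd_X.mp h)
    · exact hbd (X_dvd_X.mp h)

/-- After substitution of constants for at most six variables, `sepPoly` is a sum of two products
of distinct variables, up to an affine change of variables. -/
theorem exists_algEquiv_subst_sepPoly (S : Finset (Fin 4 × Fin 7)) (hS : S.card ≤ 6)
    (g : Fin 4 × Fin 7 → K) :
    ∃ (r : Fin 4 → Fin 7)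
      (e : MvPolynomial (Fin 4 × Fin 7) K ≃ₐ[K] MvPolynomial (Fin 4 × Fin 7) K),
      e (subst S g (sepPoly K)) = X (0, r 0) * X (1, r 1) + X (2, r 2) * X (3, r 3) ∧
        ∀ k, (e (X k)).totalDegree ≤ 1 := by
  have hr : ∀ i : Fin 4, ∃ j : Fin 7, (i, j) ∉ S := by
    intro i
    by_contra! h
    have : (Finset.univ.image fun j : Fin 7 => (i, j)) ⊆ S := by
      intro x hx
      obtain ⟨j, -, rfl⟩ := Finset.mem_image.mp hx
      exact h j
    have := Finset.card_le_card this
    rw [Finset.card_image_of_injective _ (Prod.mk_right_injective i)] at this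
    simp at this
    omega
  choose r hr using hr
  -- `d i` is the restricted row sum without the surviving variable `X (i, r i)`. It is free of all
  -- `X (k, r k)`, so translating these by `d` is inverted by translating by `-d`.
  let d : Fin 4 → MvPolynomial (Fin 4 × Fin 7) K := fun i =>
    ∑ j ∈ Finset.univ.erase (r i), subst S g (X (i, j))
  let τ : (Fin 4 → MvPolynomial (Fin 4 × Fin 7) K) →
      MvPolynomial (Fin 4 × Fin 7) K →ₐ[K] MvPolynomial (Fin 4 × Fin 7) K := fun t =>
    aeval fun k => if k.2 = r k.1 then X k + t k.1 else X k
  have hτX : ∀ t k, τ t (X k) = if k.2 = r k.1 then X k + t k.1 else X k := fun t k =>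
    aeval_X _ k
  have hτd : ∀ t i, τ t (d i) = d i := by
    intro t i
    rw [map_sum]
    refine Finset.sum_congr rfl fun j hj => ?_
    rw [subst_X]
    split_ifs
    · exact aeval_C _ _
    · rw [hτX, if_neg (Finset.ne_of_mem_erase hj)]
  have hcomp : ∀ t t' : Fin 4 → MvPolynomial (Fin 4 × Fin 7) K, (∀ i, τ t (t' i) = t' i) →
      (∀ i, t i + t' i = 0) → (τ t).comp (τ t') = AlgHom.id K _ := by
    intro t t' h1 h2
    refine algHom_ext fun k => ?_
    rw [AlgHom.comp_apply, hτX, AlgHom.id_apply]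
    split_ifs with hk
    · rw [map_add, h1, hτX, if_pos hk, add_assoc, h2, add_zero]
    · rw [hτX, if_neg hk]
  let e := AlgEquiv.ofAlgHom (τ (-d)) (τ d) (hcomp _ _ (hτd _) (fun i => by simp))
    (hcomp _ _ (fun i => by simp [hτd]) (fun i => by simp))
  have hsum : ∀ i, e (subst S g (∑ j, X (i, j))) = X (i, r i) := by
    intro i
    have : subst S g (∑ j, X (i, j)) = X (i, r i) + d i := by
      rw [map_sum, ← Finset.add_sum_erase _ _ (Finset.mem_univ (r i)), subst_X, if_neg (hr i)]
    rw [this]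
    change τ (-d) _ = _
    rw [map_add, hτd, hτX]
    simp
  refine ⟨r, e, ?_, fun k => ?_⟩
  · simp only [sepPoly, map_add, map_mul, hsum]
  · change (τ (-d) (X k)).totalDegree ≤ 1
    rw [hτX]
    split_ifs
    · refine (totalDegree_add _ _).trans (max_le (totalDegree_X _).le ?_)
      rw [Pi.neg_apply, totalDegree_neg]
      refine totalDegree_finsetSum_le fun j _ => ?_
      rw [subst_X]
      split_ifs
      · simp
      · exact (totalDegree_X _).le
    · exact (totalDegree_X _).le

theorem irreducible_subst_sepPoly (S : Finset (Fin 4 × Fin 7)) (hS : S.card ≤ 6)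
    (g : Fin 4 × Fin 7 → K) : Irreducible (subst S g (sepPoly K)) := by
  obtain ⟨r, e, he, -⟩ := exists_algEquiv_subst_sepPoly S hS g
  rw [← MulEquiv.irreducible_iff e, he]
  apply irreducible_X_mul_X_add_X_mul_X <;> simp

end SepPoly

end WidthTwo

namespace WidthTwo

open MvPolynomial Matrix

/-! ### Bilinear values and single matrices -/

section Bilin

variable {σ K : Type*} [Field K]

/-- The polynomial `aᵀ N b`. -/
noncomputable def bilin (a : Fin 2 → K) (N : Matrix (Fin 2) (Fin 2) (MvPolynomial σ K))
    (b : Fin 2 → K) : MvPolynomial σ K :=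
  ((fun i => C (a i)) ᵥ* N) ⬝ᵥ fun i => C (b i)

theorem map_bilin (φ : MvPolynomial σ K →ₐ[K] MvPolynomial σ K) (a b : Fin 2 → K)
    (N : Matrix (Fin 2) (Fin 2) (MvPolynomial σ K)) :
    φ (bilin a N b) = bilin a (φ.mapMatrix N) b := by
  have hC : ∀ c, φ (C c) = C c := fun c => φ.commutes c
  simp [bilin, vecMul, dotProduct, Fin.sum_univ_two, hC]

theorem bilin_mul_C (a b : Fin 2 → K) (N : Matrix (Fin 2) (Fin 2) (MvPolynomial σ K)) (c : K) :
    bilin a N b * C c = bilin a N (c • b) := by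
  simp [bilin, vecMul, dotProduct, Fin.sum_univ_two]
  ring

theorem C_mul_bilin (a b : Fin 2 → K) (N : Matrix (Fin 2) (Fin 2) (MvPolynomial σ K)) (c : K) :
    C c * bilin a N b = bilin (c • a) N b := by
  simp [bilin, vecMul, dotProduct, Fin.sum_univ_two]
  ring

/-- A factor of rank at most one cuts the product into two scalar factors. -/
theorem bilin_mul_vecMulVec_mul (a b u v : Fin 2 → K)
    (M N N' : Matrix (Fin 2) (Fin 2) (MvPolynomial σ K)) (hM : ∀ i j, M i j = C (u i * v j)) :
    bilin a (N * (M * N')) b = bilin a N u * bilin v N' b := by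
  simp [bilin, vecMul, dotProduct, Fin.sum_univ_two, mul_apply, hM]
  ring

theorem exists_eq_mul_of_det_eq_zero {A : Matrix (Fin 2) (Fin 2) K} (hA : A.det = 0) :
    ∃ u v : Fin 2 → K, ∀ i j, A i j = u i * v j := by
  rw [det_fin_two, sub_eq_zero] at hA
  by_cases h : A 0 0 = 0 ∧ A 0 1 = 0
  · refine ⟨![0, 1], A 1, fun i j => ?_⟩
    fin_cases i <;> fin_cases j <;> simp [h]
  obtain ⟨k, hk⟩ : ∃ k, A 0 k ≠ 0 := by
    by_contra! h'
    exact h ⟨h' 0, h' 1⟩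
  refine ⟨![1, A 1 k / A 0 k], A 0, fun i j => ?_⟩
  fin_cases i
  · simp
  · simp only [Fin.mk_one, cons_val_one, cons_val_fin_one]
    field_simp
    fin_cases j <;> fin_cases k <;> simp only [Fin.zero_eta, Fin.mk_one] <;>
      first | ring1 | linear_combination hA | linear_combination -hA

/-- The variables occurring in the entries of a matrix. -/
noncomputable def matVars [DecidableEq σ] (M : Matrix (Fin 2) (Fin 2) (MvPolynomial σ K)) :
    Finset σ :=
  Finset.univ.biUnion fun q : Fin 2 × Fin 2 => (M q.1 q.2).vars

theorem vars_subset_matVars [DecidableEq σ] (M : Matrix (Fin 2) (Fin 2) (MvPolynomial σ K))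
    (i j : Fin 2) : (M i j).vars ⊆ matVars M :=
  Finset.subset_biUnion_of_mem (fun q : Fin 2 × Fin 2 => (M q.1 q.2).vars)
    (Finset.mem_univ (i, j))

theorem subst_of_vars_subset [DecidableEq σ] {S : Finset σ} {f : MvPolynomial σ K}
    (hf : f.vars ⊆ S) (g : σ → K) : subst S g f = C (eval g f) := by
  refine hom_congr_vars (f₁ := (subst S g : MvPolynomial σ K →+* MvPolynomial σ K))
    (f₂ := C.comp (eval g)) ?_ (fun i hi _ => ?_) rfl
  · ext; simp
  · simp [subst_X, hf hi]

/-- If the entries of a matrix of simple affine forms involve four distinct variables, then all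
entries vanish simultaneously at some point. -/
theorem exists_eval_eq_zero_of_three_lt_card_matVars [DecidableEq σ]
    {M : Matrix (Fin 2) (Fin 2) (MvPolynomial σ K)} (hM : ∀ i j, M i j ∈ simpleForms σ K) :
    (matVars M).card ≤ 4 ∧
      (3 < (matVars M).card → ∃ g : σ → K, ∀ i j, eval g (M i j) = 0) := by
  classical
  choose α β x hx using hM
  set T : Finset (Fin 2 × Fin 2) := Finset.univ.filter fun q => α q.1 q.2 ≠ 0 with hT
  have hsub : matVars M ⊆ T.image fun q => x q.1 q.2 := by
    intro y hy
    obtain ⟨q, -, hq⟩ := Finset.mem_biUnion.mp hy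
    rw [hx] at hq
    have h0 : α q.1 q.2 ≠ 0 := by
      intro h0
      simp [h0] at hq
    refine Finset.mem_image.mpr ⟨q, by simp [hT, h0], ?_⟩
    have h1 := vars_add_subset _ _ hq
    rw [vars_C, Finset.union_empty] at h1
    have h2 := vars_mul _ _ h1
    simpa [vars_X, eq_comm] using h2
  have hc1 := Finset.card_le_card hsub
  have hc2 := Finset.card_image_le (s := T) (f := fun q => x q.1 q.2)
  have hc3 : T.card ≤ 4 := by simpa using Finset.card_le_univ T
  refine ⟨by omega, fun h3 => ?_⟩
  -- Four variables in four entries: each entry has its own variable, so the zeros `-β / α` can be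
  -- prescribed independently.
  have hTu : T = Finset.univ := by
    rw [← Finset.card_eq_iff_eq_univ]
    simp
    omega
  have hinj : Function.Injective fun q : Fin 2 × Fin 2 => x q.1 q.2 := by
    rw [← Set.injOn_univ, ← Finset.coe_univ, ← hTu, ← Finset.card_image_iff]
    omega
  refine ⟨Function.extend (fun q : Fin 2 × Fin 2 => x q.1 q.2)
    (fun q => -β q.1 q.2 / α q.1 q.2) 0, fun i j => ?_⟩
  have hα : α i j ≠ 0 := by
    have : (i, j) ∈ T := hTu ▸ Finset.mem_univ _
    simpa [hT] using this
  have he := hinj.extend_apply (fun q => -β q.1 q.2 / α q.1 q.2) 0 (i, j)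
  simp only at he
  rw [hx]
  simp only [map_add, map_mul, eval_C, eval_X, he]
  field_simp
  ring

end Bilin

/-! ### The lower bound for products of simple matrices -/

section Core

variable {K : Type*} [Field K]

theorem totalDegree_le_one_of_mem_simpleForms {σ : Type*} {f : MvPolynomial σ K}
    (hf : f ∈ simpleForms σ K) (φ : MvPolynomial σ K →ₐ[K] MvPolynomial σ K)
    (hφ : ∀ k, (φ (X k)).totalDegree ≤ 1) : (φ f).totalDegree ≤ 1 := by
  obtain ⟨α, β, x, rfl⟩ := hf
  have hC : ∀ c, φ (C c) = C c := fun c => φ.commutes c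
  rw [map_add, map_mul, hC, hC]
  refine (totalDegree_add _ _).trans (max_le ((totalDegree_mul _ _).trans ?_) (by simp))
  simpa using hφ x

/-- A restriction of `sepPoly` is not computed by matrices of simple affine forms whose
determinants become nonzero constants. -/
theorem subst_sepPoly_ne_bilin
    (Ns : List (Matrix (Fin 2) (Fin 2) (MvPolynomial (Fin 4 × Fin 7) K)))
    (hNs : ∀ N ∈ Ns, ∀ i j, N i j ∈ simpleForms (Fin 4 × Fin 7) K)
    (S : Finset (Fin 4 × Fin 7)) (hS : S.card ≤ 6) (g : Fin 4 × Fin 7 → K)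
    (hdet : ∀ N ∈ Ns, IsUnit (subst S g N.det)) (a b : Fin 2 → K) :
    subst S g (sepPoly K) ≠ bilin a ((subst S g).mapMatrix Ns.prod) b := by
  intro h
  obtain ⟨r, e, he, hdeg⟩ := exists_algEquiv_subst_sepPoly S hS g
  set φ : MvPolynomial (Fin 4 × Fin 7) K →ₐ[K] MvPolynomial (Fin 4 × Fin 7) K :=
    (e : MvPolynomial (Fin 4 × Fin 7) K →ₐ[K] MvPolynomial (Fin 4 × Fin 7) K).comp (subst S g)
    with hφ
  have h1 : X (0, r 0) * X (1, r 1) + X (2, r 2) * X (3, r 3) =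
      bilin a (Ns.map φ.mapMatrix).prod b := by
    rw [← map_list_prod, ← he, h]
    exact map_bilin (e : MvPolynomial (Fin 4 × Fin 7) K →ₐ[K] _) _ _ _
  refine not_irreducible_of_isUnit_det (Ns.map φ.mapMatrix) ?_ a b ?_ ?_
  · intro N hN
    obtain ⟨N, hN', rfl⟩ := List.mem_map.mp hN
    refine ⟨fun i j => totalDegree_le_one_of_mem_simpleForms (hNs N hN' i j) φ fun k => ?_, ?_⟩
    · change (e (subst S g (X k))).totalDegree ≤ 1
      rw [subst_X]
      split_ifs
      · have : e (C (g k)) = C (g k) := e.commutes _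
        rw [this]
        simp
      · exact hdeg k
    · rw [← AlgHom.map_det]
      exact (hdet N hN').map e
  · change (bilin _ _ _).IsHomogeneous 2
    rw [← h1]
    exact ((isHomogeneous_X K _).mul (isHomogeneous_X K _)).add
      ((isHomogeneous_X K _).mul (isHomogeneous_X K _))
  · change Irreducible (bilin _ _ _)
    rw [← h1]
    apply irreducible_X_mul_X_add_X_mul_X <;> simp

theorem exists_first_not {α : Type*} (Q : α → Prop) (l : List α) :
    (∀ x ∈ l, Q x) ∨ ∃ l₁ x l₂, l = l₁ ++ x :: l₂ ∧ (∀ y ∈ l₁, Q y) ∧ ¬ Q x := by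
  induction l with
  | nil => simp
  | cons x l ih =>
    by_cases hx : Q x
    · rcases ih with h | ⟨l₁, y, l₂, rfl, h₁, h₂⟩
      · exact .inl (by simpa [hx] using h)
      · exact .inr ⟨x :: l₁, y, l₂, rfl, by simpa [hx] using h₁, h₂⟩
    · exact .inr ⟨[], x, l, rfl, by simp, hx⟩

/-- No product of `2 × 2` matrices of simple affine forms computes `sepPoly`. -/
theorem bilin_prod_ne_sepPoly [IsAlgClosed K]
    (Ns : List (Matrix (Fin 2) (Fin 2) (MvPolynomial (Fin 4 × Fin 7) K)))
    (hNs : ∀ N ∈ Ns, ∀ i j, N i j ∈ simpleForms (Fin 4 × Fin 7) K) (a b : Fin 2 → K) :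
    bilin a Ns.prod b ≠ sepPoly K := by
  intro hp
  have hvars : ∀ M ∈ Ns, (matVars M).card ≤ 3 := by
    intro M hM
    by_contra! h3
    obtain ⟨h4, hg⟩ := exists_eval_eq_zero_of_three_lt_card_matVars (hNs M hM)
    obtain ⟨g, hg⟩ := hg h3
    obtain ⟨L₁, L₂, rfl⟩ := List.append_of_mem hM
    apply (irreducible_subst_sepPoly (matVars M) (by omega) g).ne_zero
    have hM0 : (subst (matVars M) g).mapMatrix M = 0 := by
      ext1 i j
      exact (subst_of_vars_subset (vars_subset_matVars M i j) g).trans (by rw [hg, C_0]; rfl)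
    rw [← hp, map_bilin, List.prod_append, List.prod_cons, map_mul, map_mul, hM0]
    simp [bilin]
  -- The suffix `L₂` is chosen shortest among those computing a restriction of `sepPoly` in at most
  -- three variables; the whole product qualifies with `S = ∅`.
  have hex : ∃ m, ∃ L₁ L₂ S g v, Ns = L₁ ++ L₂ ∧ L₂.length = m ∧ S.card ≤ 3 ∧
      subst S g (sepPoly K) = bilin v ((subst S g).mapMatrix L₂.prod) b :=
    ⟨_, [], Ns, ∅, 0, a, rfl, rfl, by simp, by rw [← hp, map_bilin]⟩
  classical
  obtain ⟨L₁, L₂, S, g, v, hL, hlen, hS, hval⟩ := Nat.find_spec hex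
  have hmin := fun m => Nat.find_min hex (m := m)
  rw [← hlen] at hmin
  clear hlen hex
  subst hL
  rcases exists_first_not (fun N => IsUnit (subst S g N.det)) L₂ with
    hall | ⟨L₃, M, L₄, rfl, hL₃, hM⟩
  · exact subst_sepPoly_ne_bilin L₂ (fun N hN => hNs N (by simp [hN])) S (by omega) g hall v b hval
  obtain ⟨h, hh⟩ := exists_eval_eq_zero hM
  rw [eval_subst] at hh
  -- The zero of the restricted determinant is extended by `g` on `S`, so that substitutions on `S`,
  -- `V` and `S ∪ V` are compatible.
  set g' : Fin 4 × Fin 7 → K := fun i => if i ∈ S then g i else h i with hg'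
  have hgg : subst S g = subst S g' := subst_congr fun i hi => by simp [hg', hi]
  rw [hgg] at hval hL₃
  have hV := hvars M (by simp)
  set V := matVars M with hVdef
  have hAdet : ((eval g').mapMatrix M).det = 0 := by rw [← RingHom.map_det]; exact hh
  obtain ⟨u, v', huv⟩ := exists_eq_mul_of_det_eq_zero hAdet
  have hsplit : ∀ (T : Finset (Fin 4 × Fin 7)), V ⊆ T → ∀ (c : Fin 2 → K) L,
      bilin c ((subst T g').mapMatrix (L ++ M :: L₄).prod) b =
        bilin c ((subst T g').mapMatrix L.prod) u *
          bilin v' ((subst T g').mapMatrix L₄.prod) b := by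
    intro T hT c L
    rw [List.prod_append, List.prod_cons, map_mul, map_mul]
    refine bilin_mul_vecMulVec_mul _ _ _ _ _ _ _ fun i j => ?_
    rw [← huv i j]
    exact subst_of_vars_subset ((vars_subset_matVars M i j).trans hT) g'
  have hpV : subst V g' (sepPoly K) = bilin a ((subst V g').mapMatrix (L₁ ++ L₃).prod) u *
      bilin v' ((subst V g').mapMatrix L₄.prod) b := by
    rw [← hp, map_bilin, ← hsplit V subset_rfl, List.append_assoc]
  rcases (irreducible_subst_sepPoly V (by omega) g').isUnit_or_isUnit hpV with hu | hu
  -- Left factor constant: the strictly shorter suffix `L₄` computes the restriction to `V`, against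
  -- minimality.
  · obtain ⟨c, -, hc⟩ := eq_C_of_isUnit hu
    rw [hc, C_mul_bilin] at hpV
    exact hmin L₄.length (by simp; omega)
      ⟨L₁ ++ L₃ ++ [M], L₄, V, g', c • v', by simp, rfl, hV, hpV⟩
  -- Right factor constant: on `S ∪ V` the product `L₃` alone computes the restriction, and its
  -- determinants remain units.
  · obtain ⟨c, -, hc⟩ := eq_C_of_isUnit hu
    have hcSV : bilin v' ((subst (S ∪ V) g').mapMatrix L₄.prod) b = C c := by
      have := congrArg (subst S g') hc
      rw [subst_C, ← map_bilin, subst_subst, map_bilin, Finset.union_comm] at this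
      exact this
    have hcard : (S ∪ V).card ≤ 6 := (Finset.card_union_le _ _).trans (by omega)
    refine subst_sepPoly_ne_bilin L₃ (fun N hN => hNs N (by simp [hN])) (S ∪ V) hcard g'
      (fun N hN => ?_) v (c • u) ?_
    · rw [← subst_subst]
      exact (hL₃ N hN).map _
    · rw [← subst_subst, hval, ← map_bilin, subst_subst, map_bilin,
        hsplit _ Finset.subset_union_right, hcSV, bilin_mul_C]

end Core

end WidthTwo

namespace WidthTwo

open MvPolynomial Matrix

/-! ### From width-two programs to matrix products -/

section Programs

variable {σ F : Type*} [Field F] {L : Set (MvPolynomial σ F)}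

open scoped Classical in
/-- The labeled adjacency matrix of a branching program. -/
noncomputable def labelMatrix (Γ : ABP L) :
    Matrix (Fin Γ.size) (Fin Γ.size) (MvPolynomial σ F) :=
  fun u v => if Γ.graph.Adj u v then Γ.label u v else 0

open scoped Classical in
-- Splitting off the first vertex of a walk matches the expansion of `A ^ (k + 1)` as `A * A ^ k`.
theorem sum_prod_paths {n : ℕ} {R : Type*} [CommSemiring R] (A : Fin n → Fin n → R) (k : ℕ)
    (s t : Fin n) :
    (∑ p : Fin (k + 1) → Fin n with p 0 = s ∧ p (Fin.last k) = t,
      ∏ i : Fin k, A (p i.castSucc) (p i.succ)) = ((Matrix.of A) ^ k) s t := by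
  induction k generalizing s with
  | zero =>
    rw [pow_zero, Matrix.one_apply, Finset.sum_filter,
      ← (Equiv.funUnique (Fin 1) (Fin n)).symm.sum_comp]
    simp [Fin.last, uniqueElim_const, Finset.filter_and, Finset.filter_eq']
    split_ifs <;> simp_all
  | succ k ih =>
    rw [pow_succ', Matrix.mul_apply, Finset.sum_filter,
      ← (Fin.consEquiv fun _ : Fin (k + 2) => Fin n).sum_comp, Fintype.sum_prod_type,
      Finset.sum_eq_single s]
    · simp only [← ih, Finset.sum_filter, Finset.mul_sum]
      rw [Finset.sum_comm]
      refine Finset.sum_congr rfl fun p _ => ?_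
      rw [Finset.sum_eq_single (p 0)]
      · simp [Fin.consEquiv, Fin.prod_univ_succ, ← Fin.succ_last]
      · intro v _ hv
        simp [hv.symm]
      · simp
    · intro u _ hu
      simp [Fin.consEquiv, hu]
    · simp

theorem value_eq (Γ : ABP L) :
    Γ.value = ∑ k ∈ Finset.range Γ.size, (labelMatrix Γ ^ k) Γ.source Γ.sink := by
  classical
  refine Finset.sum_congr rfl fun k _ => ?_
  have := sum_prod_paths (labelMatrix Γ) k Γ.source Γ.sink
  change _ = (Matrix.of (labelMatrix Γ) ^ k) _ _
  rw [← this, Finset.sum_filter, Finset.sum_filter]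
  refine Finset.sum_congr rfl fun p _ => ?_
  by_cases h : ∀ i : Fin k, Γ.graph.Adj (p i.castSucc) (p i.succ)
  · simp [ABP.IsPath, h, labelMatrix]
  · rw [if_neg fun h' => h h'.2.2]
    push Not at h
    obtain ⟨i, hi⟩ := h
    rw [Finset.prod_eq_zero (Finset.mem_univ i) (by simp [labelMatrix, hi]), ite_self]

/-- The value of a branching program of width two, if nonzero, is the value of a product of
`2 × 2` matrices whose entries are edge labels or zero. -/
theorem exists_value_eq_bilin (Γ : ABP L) (hw : Γ.width = 2) (h0 : Γ.value ≠ 0) :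
    ∃ (Ns : List (Matrix (Fin 2) (Fin 2) (MvPolynomial σ F))) (a b : Fin 2 → F),
      (∀ N ∈ Ns, ∀ i j, N i j ∈ L ∨ N i j = 0) ∧ Γ.value = bilin a Ns.prod b := by
  classical
  -- Each layer has at most two vertices, so its vertices can be numbered injectively by matrix
  -- indices.
  have hcol : ∀ k : ℤ, ∃ c : Fin Γ.size → Fin 2,
      Set.InjOn c {v | Γ.layer v = k} := by
    intro k
    have hcard : (Finset.univ.filter fun v => Γ.layer v = k).card ≤ 2 := by
      by_cases h : ∃ v, Γ.layer v = k
      · obtain ⟨v, rfl⟩ := h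
        rw [← hw]
        exact Finset.le_sup (f := fun v => (Finset.univ.filter fun u => Γ.layer u = Γ.layer v).card)
          (Finset.mem_univ v)
      · push Not at h
        simp [h]
    obtain ⟨e⟩ := Function.Embedding.nonempty_of_card_le (α := {v // Γ.layer v = k})
      (β := Fin 2) (by rwa [Fintype.card_subtype, Fintype.card_fin])
    refine ⟨fun v => if h : Γ.layer v = k then e ⟨v, h⟩ else 0, fun v hv w hw hvw => ?_⟩
    simp only [Set.mem_ofPred_eq] at hv hw
    simpa [hv, hw] using hvw
  choose c' hc' using hcol
  set c : Fin Γ.size → Fin 2 := fun v => c' (Γ.layer v) v with hc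
  have hinj : ∀ u v, Γ.layer u = Γ.layer v → c u = c v → u = v := by
    intro u v h1 h2
    simp only [hc, h1] at h2
    exact hc' (Γ.layer v) h1 rfl h2
  -- the matrix of the edges between two consecutive layers
  set N : ℤ → Matrix (Fin 2) (Fin 2) (MvPolynomial σ F) := fun k i j =>
    if h : ∃ u v, Γ.graph.Adj u v ∧ Γ.layer u = k ∧ c u = i ∧ c v = j then
      Γ.label h.choose h.choose_spec.choose else 0 with hN
  have hNmem : ∀ k i j, N k i j ∈ L ∨ N k i j = 0 := by
    intro k i j
    simp only [hN]
    split_ifs with h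
    · exact .inl (Γ.label_mem _ _ h.choose_spec.choose_spec.1)
    · exact .inr rfl
  have hNlabel : ∀ u v, Γ.layer v = Γ.layer u + 1 →
      N (Γ.layer u) (c u) (c v) = labelMatrix Γ u v := by
    intro u v huv
    simp only [hN, labelMatrix]
    by_cases hadj : Γ.graph.Adj u v
    · have h : ∃ u' v', Γ.graph.Adj u' v' ∧ Γ.layer u' = Γ.layer u ∧ c u' = c u ∧ c v' = c v :=
        ⟨u, v, hadj, rfl, rfl, rfl⟩
      rw [dif_pos h, if_pos hadj]
      obtain ⟨h1, h2, h3, h4⟩ := h.choose_spec.choose_spec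
      have e1 := hinj _ _ h2 h3
      have e2 : h.choose_spec.choose = v := by
        refine hinj _ _ ?_ h4
        rw [Γ.layer_succ _ _ h1, h2, huv]
      exact congrArg₂ Γ.label e1 e2
    · rw [if_neg hadj, dif_neg]
      rintro ⟨u', v', h1, h2, h3, h4⟩
      have e1 := hinj _ _ h2 h3
      subst e1
      have e2 : v' = v := hinj _ _ (by rw [Γ.layer_succ _ _ h1, huv]) h4
      exact hadj (e2 ▸ h1)
  have hpow : ∀ (k : ℕ) (u v : Fin Γ.size), (labelMatrix Γ ^ k) u v =
      if Γ.layer v = Γ.layer u + k then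
        ((List.range k).map fun m : ℕ => N (Γ.layer u + (m : ℤ))).prod (c u) (c v) else 0 := by
    intro k u
    induction k with
    | zero =>
      intro v
      simp only [pow_zero, List.range_zero, List.map_nil, List.prod_nil, Nat.cast_zero,
        add_zero]
      by_cases huv : u = v
      · subst huv; simp
      · rw [Matrix.one_apply_ne huv]
        split_ifs with h1
        · rw [Matrix.one_apply_ne fun h2 => huv (hinj _ _ h1.symm h2)]
        · rfl
    | succ k ih =>
      intro v
      have hl : ∀ w, Γ.layer v ≠ Γ.layer w + 1 → labelMatrix Γ w v = 0 := fun w hw =>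
        if_neg fun h => hw (Γ.layer_succ _ _ h)
      rw [pow_succ, Matrix.mul_apply]
      split_ifs with hv
      swap
      · refine Finset.sum_eq_zero fun w _ => ?_
        rw [ih]
        split_ifs with h1
        · rw [hl w (by push_cast at hv; omega), mul_zero]
        · rw [zero_mul]
      · push_cast at hv
        rw [List.range_succ, List.map_append, List.prod_append, List.map_singleton,
          List.prod_singleton, Matrix.mul_apply]
        set f : Fin 2 → MvPolynomial σ F := fun i =>
          ((List.range k).map fun m : ℕ => N (Γ.layer u + (m : ℤ))).prod (c u) i *
            N (Γ.layer u + (k : ℤ)) i (c v) with hf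
        have hterm : ∀ w, (labelMatrix Γ ^ k) u w * labelMatrix Γ w v =
            if Γ.layer w = Γ.layer u + k then f (c w) else 0 := by
          intro w
          rw [ih]
          split_ifs with h1
          · rw [hf, ← hNlabel w v (by omega), h1]
          · rw [zero_mul]
        rw [Finset.sum_congr rfl fun w _ => hterm w, ← Finset.sum_filter]
        -- The sum over a layer becomes a sum over indices; an index carried by no vertex
        -- contributes a zero row of `N`.
        refine Finset.sum_of_injOn c ?_ (fun _ _ => Finset.mem_coe.mpr (Finset.mem_univ _)) ?_ ?_
        · intro x hx y hy hxy
          simp only [Finset.coe_filter, Finset.mem_univ, true_and, Set.mem_ofPred_eq] at hx hy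
          exact hinj x y (by rw [hx, hy]) hxy
        · intro i _ hi
          have : N (Γ.layer u + (k : ℤ)) i (c v) = 0 := by
            simp only [hN]
            rw [dif_neg]
            rintro ⟨w, _, _, hw2, hw3, _⟩
            exact hi ⟨w, by simpa using hw2, hw3⟩
          simp [this]
        · intro w _
          rfl
  obtain ⟨k, hk⟩ : ∃ k : ℕ, Γ.layer Γ.sink = Γ.layer Γ.source + k := by
    by_contra! hne
    apply h0
    rw [value_eq]
    exact Finset.sum_eq_zero fun k _ => by rw [hpow, if_neg (hne k)]
  refine ⟨(List.range k).map fun m : ℕ => N (Γ.layer Γ.source + (m : ℤ)),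
    Pi.single (c Γ.source) 1, Pi.single (c Γ.sink) 1, ?_, ?_⟩
  · intro M hM i j
    obtain ⟨m, -, rfl⟩ := List.mem_map.mp hM
    exact hNmem _ i j
  · have hval : Γ.value = (labelMatrix Γ ^ k) Γ.source Γ.sink := by
      rw [value_eq] at h0 ⊢
      have hz : ∀ k' ∈ Finset.range Γ.size, k' ≠ k →
          (labelMatrix Γ ^ k') Γ.source Γ.sink = 0 := by
        intro k' _ hne
        rw [hpow, if_neg (by omega)]
      -- If `k` were outside the range of lengths in `value`, every term would vanish, against `h0`.
      refine Finset.sum_eq_single k hz fun hk' => ?_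
      exact absurd (Finset.sum_eq_zero fun k' h => hz k' h fun e => hk' (e ▸ h)) h0
    have hC : ∀ i, (fun j => (C ((Pi.single i 1 : Fin 2 → F) j) : MvPolynomial σ F)) = Pi.single i 1 := by
      intro i
      funext j
      by_cases h : j = i
      · subst h; simp
      · simp [h]
    rw [hval, hpow, if_pos hk, bilin, hC, hC]
    simp

end Programs

end WidthTwo

namespace WidthTwo

open MvPolynomial Matrix

/-! ### Separation of the two classes -/

section Separation

theorem eval₂Hom_mem_simpleForms {σ τ F K : Type*} [Field F] [Field K] (ψ : F →+* K) (x : τ → σ)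
    {f : MvPolynomial τ F} (hf : f ∈ simpleForms τ F) :
    eval₂Hom (C.comp ψ) (fun k => X (x k)) f ∈ simpleForms σ K := by
  obtain ⟨α, β, k, rfl⟩ := hf
  exact ⟨ψ α, ψ β, x k, by simp⟩

/-- No weak branching program of width two computes a polynomial that becomes `sepPoly` after a
renaming of variables and an extension of scalars to an algebraically closed field. -/
theorem eval₂Hom_value_ne_sepPoly {τ F K : Type*} [Field F] [Field K] [IsAlgClosed K]
    (ψ : F →+* K) (x : τ → Fin 4 × Fin 7) (Γ : ABP (simpleForms τ F)) (hw : Γ.width = 2) :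
    eval₂Hom (C.comp ψ) (fun k => X (x k)) Γ.value ≠ sepPoly K := by
  intro h
  set φ := eval₂Hom (C.comp ψ) (fun k => (X (x k) : MvPolynomial (Fin 4 × Fin 7) K)) with hφ
  by_cases h0 : Γ.value = 0
  · have hirr := irreducible_subst_sepPoly (K := K) ∅ (by simp) 0
    rw [h0, map_zero] at h
    rw [← h, map_zero] at hirr
    exact not_irreducible_zero hirr
  obtain ⟨Ns, a, b, hNs, hval⟩ := exists_value_eq_bilin Γ hw h0
  refine bilin_prod_ne_sepPoly (Ns.map φ.mapMatrix) ?_ (fun i => ψ (a i)) (fun i => ψ (b i)) ?_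
  · intro N hN i j
    obtain ⟨N, hN', rfl⟩ := List.mem_map.mp hN
    rcases hNs N hN' i j with hs | hz
    · exact eval₂Hom_mem_simpleForms ψ x hs
    -- A missing edge gives the entry `0`, itself a simple form; the index is arbitrary.
    · exact ⟨0, 0, (0, 0), by simp [hz]⟩
  · rw [← h, hval, ← map_list_prod]
    simp [bilin, vecMul, dotProduct, Fin.sum_univ_two, hφ]

theorem map_sepPoly {F K : Type*} [Field F] [Field K] (ψ : F →+* K) :
    eval₂Hom (C.comp ψ) (fun k => X k) (sepPoly F) = sepPoly K := by
  simp [sepPoly]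

variable {σ F : Type*} [Field F]

theorem sum_X_mem_generalForms {ι : Type*} [Fintype ι] (x : ι → σ) :
    ∑ j, X (x j) ∈ generalForms σ F := by
  classical
  refine ⟨∑ j, Finsupp.single (x j) 1, 0, ?_⟩
  rw [← Finsupp.sum_finsetSum_index (by simp) (by intros; simp [add_mul])]
  simp

/-- The branching program with two internal vertices that computes `l 0 * l 1 + l 2 * l 3`. -/
noncomputable def diamond {L : Set (MvPolynomial σ F)} (l : Fin 4 → MvPolynomial σ F) (hl : ∀ i, l i ∈ L) :
    ABP L where
  size := 4
  graph := { Adj := fun u v => (![0, 1, 1, 2] : Fin 4 → ℤ) v = (![0, 1, 1, 2] : Fin 4 → ℤ) u + 1 }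
  source := 0
  sink := 3
  layer := ![0, 1, 1, 2]
  layer_succ _ _ h := h
  label := ![![0, l 0, l 2, 0], ![0, 0, 0, l 1], ![0, 0, 0, l 3], ![0, 0, 0, 0]]
  label_mem u v h := by
    fin_cases u <;> fin_cases v <;> simp at h ⊢ <;> exact hl _

theorem width_diamond {L : Set (MvPolynomial σ F)} (l : Fin 4 → MvPolynomial σ F)
    (hl : ∀ i, l i ∈ L) : (diamond l hl).width = 2 := by
  change (Finset.univ.sup fun v : Fin 4 => (Finset.univ.filter fun u : Fin 4 =>
    (![0, 1, 1, 2] : Fin 4 → ℤ) u = (![0, 1, 1, 2] : Fin 4 → ℤ) v).card) = 2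
  decide

theorem value_diamond {L : Set (MvPolynomial σ F)} (l : Fin 4 → MvPolynomial σ F)
    (hl : ∀ i, l i ∈ L) : (diamond l hl).value = l 0 * l 1 + l 2 * l 3 := by
  have hA : labelMatrix (diamond l hl) = Matrix.of
      ![![0, l 0, l 2, 0], ![0, 0, 0, l 1], ![0, 0, 0, l 3], ![0, 0, 0, 0]] := by
    funext u v
    change Fin 4 at u v
    fin_cases u <;> fin_cases v <;> simp [labelMatrix, diamond]
  rw [value_eq, hA]
  change ∑ k ∈ Finset.range 4, ((Matrix.of
      ![![0, l 0, l 2, 0], ![0, 0, 0, l 1], ![0, 0, 0, l 3], ![0, 0, 0, 0]] :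
      Matrix (Fin 4) (Fin 4) (MvPolynomial σ F)) ^ k) 0 3 = _
  simp [Finset.sum_range_succ, pow_succ, Matrix.mul_apply, Fin.sum_univ_four]

/-- `sepPoly` with renamed variables is computed by a general branching program of
width two and size four. -/
theorem exists_value_eq_rename_sepPoly (x : Fin 4 × Fin 7 → σ) :
    ∃ Γ : ABP (generalForms σ F), Γ.width = 2 ∧ Γ.size ≤ 4 ∧ Γ.value = rename x (sepPoly F) := by
  refine ⟨diamond (fun i => ∑ j, X (x (i, j))) fun i =>
    sum_X_mem_generalForms _, width_diamond _ _, le_rfl, ?_⟩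
  rw [value_diamond]
  simp [sepPoly]

theorem simpleForms_subset_generalForms : simpleForms σ F ⊆ generalForms σ F := by
  rintro _ ⟨α, β, i, rfl⟩
  exact ⟨Finsupp.single i α, β, by simp⟩

/-- The class of polynomial families grows with the set of edge labels. -/
theorem VP_mono {k : ℕ} {L L' : Set (MvPolynomial ℕ F)} (h : L ⊆ L') : VP k L ⊆ VP k L' := by
  rintro f ⟨hf, t, ht, hΓ⟩
  refine ⟨hf, t, ht, fun n => ?_⟩
  obtain ⟨Γ, h1, h2, h3⟩ := hΓ n
  exact ⟨{ Γ with label_mem := fun u v huv => h (Γ.label_mem u v huv) }, h1, h2, h3⟩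

theorem polyBounded_const (c : ℕ) : PolyBounded fun _ => c :=
  ⟨Polynomial.C c, by simp⟩

theorem VPweak_two_ssubset_VPgen_two (F : Type*) [Field F] : VPweak F 2 ⊂ VPgen F 2 := by
  refine ⟨VP_mono simpleForms_subset_generalForms, fun hsub => ?_⟩
  obtain ⟨x, hx⟩ : ∃ x : Fin 4 × Fin 7 → ℕ, Function.Injective x :=
    ⟨fun q => finProdFinEquiv q, Fin.val_injective.comp finProdFinEquiv.injective⟩
  have hgen : (fun _ => rename x (sepPoly F)) ∈ VPgen F 2 :=
    ⟨polyBounded_const _, _, polyBounded_const 4, fun _ => exists_value_eq_rename_sepPoly x⟩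
  obtain ⟨-, t, -, ht⟩ := hsub hgen
  obtain ⟨Γ, hw, -, hv⟩ := ht 0
  -- Renaming back along `invFun x` keeps labels simple. Variables outside the range of `x` go to an
  -- arbitrary variable, which is harmless since they do not occur in the value.
  refine eval₂Hom_value_ne_sepPoly (algebraMap F (AlgebraicClosure F)) (Function.invFun x) Γ hw ?_
  rw [hv, coe_eval₂Hom, eval₂_rename, ← map_sepPoly (algebraMap F (AlgebraicClosure F)),
    coe_eval₂Hom]
  congr 1
  funext q
  simp [Function.leftInverse_invFun hx q]

end Separation

end WidthTwo

theorem theorem5p3 (F : Type*) [Field F] :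
    (∃ Γ : ABP (generalForms (Fin 4 × Fin 7) F), Γ.width = 2 ∧ Γ.value = sepPoly F) ∧
    (¬ ∃ Γ : ABP (simpleForms (Fin 4 × Fin 7) F), Γ.width = 2 ∧ Γ.value = sepPoly F) ∧
    VPweak F 2 ⊂ VPgen F 2 := by
  refine ⟨?_, ?_, WidthTwo.VPweak_two_ssubset_VPgen_two F⟩
  · obtain ⟨Γ, hw, -, hv⟩ := WidthTwo.exists_value_eq_rename_sepPoly (F := F) id
    exact ⟨Γ, hw, by rw [hv, MvPolynomial.rename_id_apply]⟩
  · rintro ⟨Γ, hw, hv⟩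
    refine WidthTwo.eval₂Hom_value_ne_sepPoly (algebraMap F (AlgebraicClosure F)) id Γ hw ?_
    rw [hv]
    exact WidthTwo.map_sepPoly _
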